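/- Let $d\ge 2$. The complete $d$-uniform hypergraph $K^d_{2d}$ has $2d$ vertices, and its hyperedges are all $d$-element sets of vertices. Place its $2d$ vertices at any $2d$ distinct points of the moment curve $\{(t,t^2,\dots,t^d): t\in\mathbb{R}\}\subset\mathbb{R}^d$, and draw each hyperedge as the $(d-1)$-simplex that is the convex hull of its $d$ vertices. Two hyperedges are crossing if they have no common vertex and the relative interiors of their simplices have a common point. Then the number $c_d^m$ of (unordered) crossing pairs of hyperedges of $K^d_{2d}$ does not depend on the choice of the points on the curve, and $$c_d^m=\begin{cases}\displaystyle\binom{2d-1}{d-1}-\sum_{i=1}^{d/2}\binom{d}{i}\binom{d-1}{i-1} & \text{if } d \text{ is even},\\[2ex] \displaystyle\binom{2d-1}{d-1}-1-\sum_{i=1}^{\lfloor d/2\rfloor}\binom{d-1}{i}\binom{d}{i} & \text{if } d \text{ is odd}.\end{cases}$$ Moreover, $c_d^m=\Theta\!\left(4^d/\sqrt d\right)$ as $d\to\infty$. -/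

import Mathlib

/-- The complete `d`-uniform hypergraph `K^d_n`: its vertices are the elements of `Fin n`, and its
hyperedges are all sets of exactly `d` vertices. -/
def completeUniformHypergraph (d n : ℕ) : Hypergraph (Fin n) where
  vertexSet := Set.univ
  edgeSet := {e | e.ncard = d}
  subset_vertexSet_of_mem_edgeSet' := fun _ _ => Set.subset_univ _

/-- The `d`-dimensional moment curve `{(t, t², …, t^d) : t ∈ ℝ}` (coordinate `k : Fin d`, counted
from `0`, is `t ^ (k + 1)`). -/
def momentCurve (d : ℕ) : Set (EuclideanSpace ℝ (Fin d)) :=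
  Set.range fun t : ℝ => WithLp.toLp 2 fun k : Fin d => t ^ ((k : ℕ) + 1)

/-- A placement of the vertices in `ℝ^d` puts them on the moment curve, at distinct points. -/
def IsMomentCurvePlacement {V : Type*} {d : ℕ} (p : V → EuclideanSpace ℝ (Fin d)) : Prop :=
  Function.Injective p ∧ ∀ v, p v ∈ momentCurve d

/-- Two hyperedges, drawn as the convex hulls of their vertices, are crossing if they are vertex
disjoint and have a common point in their relative interiors. -/
def AreCrossing {V : Type*} {d : ℕ} (p : V → EuclideanSpace ℝ (Fin d)) (A B : Set V) : Prop :=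
  Disjoint A B ∧
    (intrinsicInterior ℝ (convexHull ℝ (p '' A)) ∩
      intrinsicInterior ℝ (convexHull ℝ (p '' B))).Nonempty

/-- The set of (unordered) crossing pairs of hyperedges of `H`, for the vertex placement `p`. -/
def crossingPairs {V : Type*} {d : ℕ} (H : Hypergraph V) (p : V → EuclideanSpace ℝ (Fin d)) :
    Set (Sym2 (Set V)) :=
  {z | ∃ A ∈ H.edgeSet, ∃ B ∈ H.edgeSet, AreCrossing p A B ∧ z = s(A, B)}

/-- The number of crossing pairs of hyperedges of `K^d_{2d}` for the vertex placement `p`. -/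
noncomputable def numCrossingPairs (d : ℕ) (p : Fin (2 * d) → EuclideanSpace ℝ (Fin d)) : ℕ :=
  (crossingPairs (completeUniformHypergraph d (2 * d)) p).ncard

/-!
Order the `2 * d` vertices by their parameters on the moment curve. Two disjoint hyperedges are
complementary, so an unordered pair of them is a binary word of length `2 * d` with `d` letters of
each kind, normalized to start with `true`. The simplices cross exactly when this word has at least
`d + 1` changes of letter (`areCrossing_iff_le_blockIndex`).

* If there are at most `d` changes, the polynomial with one root at each change has degree at most
  `d`. It is an affine functional on the curve that separates the two simplices
  (`exists_polynomial_of_blocks`, `not_areCrossing_of_polynomial`).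
* If there are at least `d + 1` changes, each vertex belongs to a set of `d + 2` vertices from
  consecutive blocks of the word. The divided difference at these vertices vanishes on polynomials
  of degree at most `d` and has alternating coefficients. Summed over all vertices, these give an
  affine dependency that is positive on one hyperedge and negative on the other, hence a common
  point with positive weights in both simplices (`exists_dependency_of_blocks`,
  `areCrossing_of_dependency`, `sum_smul_mem_intrinsicInterior_convexHull`).

The criterion does not depend on the placement. Words with `c` changes are counted by pairs of
compositions of `d` (`card_words`). Vandermonde's identity gives the total
`(2 * d - 1).choose (d - 1)`, and the words with at most `d` changes, taken two numbers of changes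
at a time, give the sums in the two closed formulas.

For the order of growth, the number of words with `c` changes is symmetric under `c ↦ 2 * d - c`, so
twice the number of crossing pairs is the total minus the number of words with exactly `d` changes.
That number is a single square in the sum `∑ i, (d - 1).choose i ^ 2 = (2 * d - 2).choose (d - 1)`
and hence at most `2 / 3` of the total. Thus the crossing pairs are at least one sixth of all pairs,
and the bounds `4 ^ d / (2 * √d) ≤ Nat.centralBinom d ≤ 4 ^ d / √d` finish the proof.
-/

/-! ### Relative interiors of convex hulls of finite families -/

theorem mem_intrinsicInterior_iff_ball {E : Type*} [NormedAddCommGroup E] [NormedSpace ℝ E]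
    {C : Set E} {x : E} :
    x ∈ intrinsicInterior ℝ C ↔
      x ∈ affineSpan ℝ C ∧ ∃ ε > 0, ∀ u ∈ affineSpan ℝ C, dist u x < ε → u ∈ C := by
  rw [mem_intrinsicInterior]
  constructor
  · rintro ⟨y, hy, rfl⟩
    refine ⟨y.2, ?_⟩
    obtain ⟨ε, hε, h⟩ := Metric.mem_nhds_iff.1 (mem_interior_iff_mem_nhds.1 hy)
    exact ⟨ε, hε, fun u hu hd => @h ⟨u, hu⟩ hd⟩
  · rintro ⟨hx, ε, hε, h⟩
    refine ⟨⟨x, hx⟩, mem_interior_iff_mem_nhds.2 (Metric.mem_nhds_iff.2 ⟨ε, hε, ?_⟩), rfl⟩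
    intro u hu
    exact h u u.2 hu

/-- A point of a segment from a point `z` of a convex set to a point `x` of its relative interior
lies in the relative interior, unless it is `z`. -/
theorem Convex.combo_mem_intrinsicInterior {E : Type*} [NormedAddCommGroup E] [NormedSpace ℝ E]
    {C : Set E} (hC : Convex ℝ C) {x z : E} (hx : x ∈ intrinsicInterior ℝ C) (hz : z ∈ C)
    {r : ℝ} (hr : 0 < r) (hr' : r ≤ 1) : (1 - r) • z + r • x ∈ intrinsicInterior ℝ C := by
  have hxC := intrinsicInterior_subset hx
  rw [mem_intrinsicInterior_iff_ball] at hx ⊢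
  obtain ⟨hxs, ε, hε, h⟩ := hx
  refine ⟨subset_affineSpan ℝ C (hC hz hxC (by linarith) hr.le (by ring)), r * ε, by positivity, ?_⟩
  intro u hu hd
  -- the homothety with centre `z` and ratio `r⁻¹` takes `u` into the ball around `x`
  have hu' : AffineMap.lineMap z u r⁻¹ ∈ C := by
    apply h
    · exact AffineMap.lineMap_mem r⁻¹ (subset_affineSpan ℝ C hz) hu
    · rw [dist_eq_norm] at hd ⊢
      have : AffineMap.lineMap z u r⁻¹ - x = r⁻¹ • (u - ((1 - r) • z + r • x)) := by
        have := hr.ne'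
        rw [AffineMap.lineMap_apply_module']
        match_scalars <;> field_simp
        ring
      rw [this, norm_smul, norm_inv, Real.norm_of_nonneg hr.le]
      rwa [inv_mul_lt_iff₀ hr]
  have : u = (1 - r) • z + r • AffineMap.lineMap z u r⁻¹ := by
    rw [AffineMap.lineMap_apply_module', smul_add, smul_smul, mul_inv_cancel₀ hr.ne']
    module
  rw [this]
  exact hC hz hu' (by linarith) hr.le (by ring)

/-- A convex combination with all weights positive lies in the relative interior of the convex
hull. The points need not be affinely independent. -/
theorem sum_smul_mem_intrinsicInterior_convexHull {E V : Type*} [NormedAddCommGroup E]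
    [NormedSpace ℝ E] [FiniteDimensional ℝ E] (s : Finset V) (p : V → E) (w : V → ℝ)
    (hw : ∀ i ∈ s, 0 < w i) (hw1 : ∑ i ∈ s, w i = 1) :
    ∑ i ∈ s, w i • p i ∈ intrinsicInterior ℝ (convexHull ℝ (p '' s)) := by
  classical
  have hconv := convex_convexHull ℝ (p '' (s : Set V))
  have hs : s.Nonempty := by
    rw [Finset.nonempty_iff_ne_empty]; rintro rfl; simp at hw1
  have hmem : ∀ v : V → ℝ, (∀ i ∈ s, 0 ≤ v i) → ∑ i ∈ s, v i = 1 →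
      ∑ i ∈ s, v i • p i ∈ convexHull ℝ (p '' (s : Set V)) := fun v h0 h1 =>
    hconv.sum_mem h0 h1 fun i hi => subset_convexHull ℝ _ ⟨i, hi, rfl⟩
  obtain ⟨x, hx⟩ := (hs.to_set.image p).convexHull (𝕜 := ℝ) |>.intrinsicInterior hconv
  have hxC := intrinsicInterior_subset hx
  obtain ⟨v, hv0, hv1, rfl⟩ : ∃ v : V → ℝ, (∀ i ∈ s, 0 ≤ v i) ∧ ∑ i ∈ s, v i = 1 ∧
      ∑ i ∈ s, v i • p i = x := by
    have : convexHull ℝ (p '' (s : Set V)) ⊆ {x | ∃ v : V → ℝ, (∀ i ∈ s, 0 ≤ v i) ∧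
        ∑ i ∈ s, v i = 1 ∧ ∑ i ∈ s, v i • p i = x} := by
      refine convexHull_min ?_ ?_
      · rintro _ ⟨i, hi, rfl⟩
        refine ⟨Pi.single i 1, fun j _ => ?_, ?_, ?_⟩
        · by_cases h : j = i
          · subst h; simp
          · simp [h]
        · simpa [Finset.sum_pi_single] using hi
        · have hi' : i ∈ s := hi
          simp [Pi.single_apply, ite_smul, hi']
      · rintro _ ⟨v, hv, hv1, rfl⟩ _ ⟨v', hv', hv1', rfl⟩ a b ha hb hab
        refine ⟨fun i => a * v i + b * v' i, fun i hi => ?_, ?_, ?_⟩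
        · have := hv i hi; have := hv' i hi; positivity
        · rw [Finset.sum_add_distrib, ← Finset.mul_sum, ← Finset.mul_sum, hv1, hv1']; linarith
        · simp only [add_smul, mul_smul, Finset.sum_add_distrib, Finset.smul_sum]
    exact this hxC
  -- `w` dominates a small multiple of `v`, the rest is the other end point of a segment
  obtain ⟨m, hm, hmin⟩ := s.exists_min_image w hs
  set r := min (w m) (1 / 2) with hr
  have hr0 : 0 < r := lt_min (hw m hm) (by norm_num)
  have hr1 : r ≤ 1 / 2 := min_le_right _ _
  have hv1' : ∀ i ∈ s, v i ≤ 1 := fun i hi => hv1 ▸ Finset.single_le_sum hv0 hi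
  have hne : (1 - r) ≠ 0 := by linarith
  have hz := hmem (fun i => (1 - r)⁻¹ * (w i - r * v i)) (fun i hi => by
      have h1 := hv1' i hi
      have h2 := hmin i hi
      have h3 : r ≤ w m := min_le_left _ _
      have : r * v i ≤ r * 1 := mul_le_mul_of_nonneg_left h1 hr0.le
      exact mul_nonneg (inv_nonneg.2 (by linarith)) (by linarith))
    (by rw [← Finset.mul_sum, Finset.sum_sub_distrib, ← Finset.mul_sum, hv1, hw1, mul_one,
      inv_mul_cancel₀ hne])
  have := hconv.combo_mem_intrinsicInterior hx hz hr0 (by linarith)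
  convert this using 1
  rw [Finset.smul_sum, Finset.smul_sum, ← Finset.sum_add_distrib]
  refine Finset.sum_congr rfl fun i _ => ?_
  rw [smul_smul, smul_smul, ← add_smul, mul_inv_cancel_left₀ hne]
  congr 1; ring

/-! ### Crossing on the moment curve in terms of polynomials -/

open Polynomial in
/-- A polynomial of degree at most `d` is an affine functional on the moment curve, so one that is
positive on `A` and negative on `B` separates the two simplices. -/
theorem not_areCrossing_of_polynomial {V : Type*} {d : ℕ} {p : V → EuclideanSpace ℝ (Fin d)}
    {τ : V → ℝ} (hp : ∀ v (k : Fin d), p v k = τ v ^ ((k : ℕ) + 1)) {A B : Set V} (q : ℝ[X])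
    (hq : q.natDegree ≤ d) (hA : ∀ v ∈ A, 0 < q.eval (τ v)) (hB : ∀ v ∈ B, q.eval (τ v) < 0) :
    ¬ AreCrossing p A B := by
  rintro ⟨-, x, hxA, hxB⟩
  let ℓ : EuclideanSpace ℝ (Fin d) →ₗ[ℝ] ℝ :=
    ∑ k : Fin d, q.coeff ((k : ℕ) + 1) • (EuclideanSpace.proj k).toLinearMap
  have hℓ : ∀ v, ℓ (p v) = q.eval (τ v) - q.coeff 0 := by
    intro v
    rw [Polynomial.eval_eq_sum_range' (Nat.lt_succ_of_le hq), Finset.sum_range_succ']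
    simp [ℓ, hp, Finset.sum_range]
  have h1 : convexHull ℝ (p '' A) ⊆ {x | -q.coeff 0 < ℓ x} := by
    refine convexHull_min ?_ (convex_halfSpace_gt ℓ.isLinear _)
    rintro _ ⟨v, hv, rfl⟩
    have := hA v hv
    simp only [Set.mem_ofPred_eq, hℓ]; linarith
  have h2 : convexHull ℝ (p '' B) ⊆ {x | ℓ x < -q.coeff 0} := by
    refine convexHull_min ?_ (convex_halfSpace_lt ℓ.isLinear _)
    rintro _ ⟨v, hv, rfl⟩
    have := hB v hv
    simp only [Set.mem_ofPred_eq, hℓ]; linarith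
  have h1' := h1 (intrinsicInterior_subset hxA)
  have h2' := h2 (intrinsicInterior_subset hxB)
  simp only [Set.mem_ofPred_eq] at h1' h2'
  linarith

open Polynomial in
/-- Splitting an affine dependency of the points, with positive coefficients on `A` and negative
ones elsewhere, gives a common point of the two relative interiors. -/
theorem areCrossing_of_dependency {V : Type*} [Fintype V] {d : ℕ}
    {p : V → EuclideanSpace ℝ (Fin d)}
    {τ : V → ℝ} (hp : ∀ v (k : Fin d), p v k = τ v ^ ((k : ℕ) + 1)) {A : Set V}
    (hne : A.Nonempty) (l : V → ℝ)
    (hl : ∀ q : ℝ[X], q.natDegree ≤ d → ∑ v, l v * q.eval (τ v) = 0)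
    (hA : ∀ v ∈ A, 0 < l v) (hB : ∀ v ∈ Aᶜ, l v < 0) : AreCrossing p A Aᶜ := by
  classical
  refine ⟨disjoint_compl_right, ?_⟩
  set s : Finset V := A.toFinset
  have hs : (s : Set V) = A := Set.coe_toFinset A
  have hs' : ((sᶜ : Finset V) : Set V) = Aᶜ := by rw [Finset.coe_compl, hs]
  have hsplit : ∀ g : V → ℝ, ∑ v, g v = 0 → ∑ v ∈ s, g v = ∑ v ∈ sᶜ, -g v := fun g hg => by
    rw [← Finset.sum_add_sum_compl s] at hg
    rw [Finset.sum_neg_distrib]; linarith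
  have h0 := hsplit l (by simpa using hl 1 (by simp))
  have hSpos : 0 < ∑ v ∈ s, l v :=
    Finset.sum_pos (fun v hv => hA v (hs ▸ hv)) (by rwa [← Finset.coe_nonempty, hs])
  set S := ∑ v ∈ s, l v with hS
  have m1 := sum_smul_mem_intrinsicInterior_convexHull s p (fun v => S⁻¹ * l v)
    (fun v hv => mul_pos (inv_pos.2 hSpos) (hA v (hs ▸ hv)))
    (by rw [← Finset.mul_sum, inv_mul_cancel₀ hSpos.ne'])
  have m2 := sum_smul_mem_intrinsicInterior_convexHull sᶜ p (fun v => S⁻¹ * -l v)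
    (fun v hv => mul_pos (inv_pos.2 hSpos) (neg_pos.2 (hB v (by rw [← hs']; exact hv))))
    (by rw [← Finset.mul_sum, ← h0, inv_mul_cancel₀ hSpos.ne'])
  rw [hs] at m1
  rw [hs'] at m2
  refine ⟨_, m1, ?_⟩
  convert m2 using 1
  ext k
  have hk := hsplit (fun v => l v * τ v ^ ((k : ℕ) + 1))
    (by simpa using hl (X ^ ((k : ℕ) + 1)) (by simp))
  simp only [WithLp.ofLp_sum, WithLp.ofLp_smul, Finset.sum_apply, Pi.smul_apply, smul_eq_mul, hp,
    mul_assoc, ← Finset.mul_sum]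
  rw [hk]
  simp

/-! ### Polynomials and affine dependencies with prescribed block signs -/

open Polynomial in
/-- Let `b` number consecutive blocks of points of the line by `0, …, c`. One root between any two
neighbouring blocks gives a polynomial of degree at most `c` whose sign on block `k` is
`(-1) ^ k`. -/
theorem exists_polynomial_of_blocks {ι : Type*} [Finite ι] {t : ι → ℝ} {b : ι → ℕ}
    (htb : ∀ i j, b i < b j → t i < t j) {c : ℕ} (hb : ∀ i, b i ≤ c) :
    ∃ q : ℝ[X], q.natDegree ≤ c ∧ ∀ i, 0 < (-1) ^ (b i) * q.eval (t i) := by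
  classical
  cases nonempty_fintype ι
  have hm : ∀ k : ℕ, ∃ m : ℝ, (∀ i, b i ≤ k → t i < m) ∧ ∀ i, k < b i → m < t i := by
    intro k
    obtain ⟨m, h1, h2⟩ := Order.exists_between_finsets
      ((Finset.univ.filter fun i => b i ≤ k).image t) ((Finset.univ.filter fun i => k < b i).image t)
      (by simp only [Finset.mem_image, Finset.mem_filter, Finset.mem_univ, true_and]
          rintro _ ⟨i, hi, rfl⟩ _ ⟨j, hj, rfl⟩
          exact htb i j (by omega))
    refine ⟨m, fun i hi => h1 _ ?_, fun i hi => h2 _ ?_⟩ <;>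
      exact Finset.mem_image_of_mem t (by simpa using hi)
  choose m hm1 hm2 using hm
  refine ⟨∏ k ∈ Finset.range c, (C (m k) - X), ?_, fun i => ?_⟩
  · refine (natDegree_prod_le _ _).trans ((Finset.sum_le_card_nsmul _ _ 1 fun k _ => ?_).trans
      (by simp))
    compute_degree
  · have hr : Finset.range c = Finset.range (b i) ∪ Finset.Ico (b i) c := by
      ext k; have := hb i; simp; omega
    have hd : Disjoint (Finset.range (b i)) (Finset.Ico (b i) c) := by
      rw [Finset.disjoint_left]; intro k; simp; omega
    rw [eval_prod, hr, Finset.prod_union hd, ← mul_assoc]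
    refine mul_pos ?_ (Finset.prod_pos fun k hk => ?_)
    · have : ((-1 : ℝ)) ^ b i = ∏ k ∈ Finset.range (b i), (-1) := by simp
      rw [this, ← Finset.prod_mul_distrib]
      refine Finset.prod_pos fun k hk => ?_
      have := hm2 k i (by simpa using hk)
      simp; linarith
    · have := hm1 k i (by simp at hk; omega)
      simp; linarith

/-- The denominators of a divided difference alternate in sign. -/
theorem prod_erase_sub_sign {v : ℕ → ℝ} {a e k : ℕ} (hk : k ∈ Finset.Icc a e)
    (hv : StrictMonoOn v (Finset.Icc a e : Set ℕ)) :
    0 < (-1) ^ (e - k) * ∏ j ∈ (Finset.Icc a e).erase k, (v k - v j) := by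
  have hk' := Finset.mem_Icc.1 hk
  have hr : (Finset.Icc a e).erase k = Finset.Ico a k ∪ Finset.Ioc k e := by
    ext j; simp; omega
  have hd : Disjoint (Finset.Ico a k) (Finset.Ioc k e) := by
    rw [Finset.disjoint_left]; intro k; simp; omega
  rw [hr, Finset.prod_union hd, mul_left_comm]
  refine mul_pos (Finset.prod_pos fun j hj => ?_) ?_
  · have hj := Finset.mem_Ico.1 hj
    have := hv (a := j) (b := k) (by simp; omega) (by simp; omega) hj.2
    linarith
  · have : ((-1 : ℝ)) ^ (e - k) = ∏ k ∈ Finset.Ioc k e, (-1) := by simp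
    rw [this, ← Finset.prod_mul_distrib]
    refine Finset.prod_pos fun j hj => ?_
    have hj := Finset.mem_Ioc.1 hj
    have := hv (a := k) (b := j) (by simp; omega) (by simp; omega) hj.1
    linarith

open Polynomial in
/-- If there are at least `d + 2` nonempty blocks, then the divided difference of order `d + 1` at
one point of each of `d + 2` consecutive blocks annihilates the polynomials of degree at most `d`;
its coefficients have the signs `(-1) ^ k` of their blocks, up to a common sign. The window and the
points can be chosen so that a given point `i₀` is among the nodes. -/
theorem exists_local_dependency_of_blocks {ι : Type*} [Fintype ι] {t : ι → ℝ} {b : ι → ℕ}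
    (htb : ∀ i j, b i < b j → t i < t j) {c d : ℕ} (hd : d + 1 ≤ c)
    (hb : ∀ i, b i ≤ c) (hs : ∀ k ≤ c, ∃ i, b i = k) (i₀ : ι) :
    ∃ l : ι → ℝ, (∀ q : ℝ[X], q.natDegree ≤ d → ∑ i, l i * q.eval (t i) = 0) ∧
      (∀ i, 0 ≤ (-1) ^ (b i) * l i) ∧ 0 < (-1) ^ (b i₀) * l i₀ := by
  classical
  obtain ⟨r, hr, hr0⟩ : ∃ r : ℕ → ι, (∀ k ≤ c, b (r k) = k) ∧ r (b i₀) = i₀ := by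
    have : Nonempty ι := ⟨i₀⟩
    choose! r hr using hs
    refine ⟨Function.update r (b i₀) i₀, fun k hk => ?_, by simp⟩
    by_cases h : k = b i₀
    · subst h; simp
    · simp [h, hr k hk]
  -- a window of `d + 2` consecutive blocks that contains the block of `i₀`
  set e := max (b i₀) (d + 1) with he
  set a := e - (d + 1) with ha
  have hb0 := hb i₀
  have hae : a + (d + 1) = e ∧ e ≤ c ∧ a ≤ b i₀ ∧ b i₀ ≤ e := by omega
  set s := Finset.Icc a e with hsdef
  have hv : StrictMonoOn (fun k => t (r k)) (s : Set ℕ) := by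
    intro j hj k hk hjk
    simp only [hsdef, Finset.coe_Icc, Set.mem_Icc] at hj hk
    refine htb _ _ ?_
    rw [hr j (by omega), hr k (by omega)]; exact hjk
  have hcard : s.card = d + 2 := by simp [hsdef]; omega
  set w : ℕ → ℝ := fun k => (∏ j ∈ s.erase k, (t (r k) - t (r j)))⁻¹ with hw
  have hwpos : ∀ k ∈ s, 0 < (-1 : ℝ) ^ (e - k) * w k := fun k hk => by
    have := inv_pos.2 (prod_erase_sub_sign hk hv)
    rwa [mul_inv, ← inv_pow, inv_neg, inv_one] at this
  have hwpos' : ∀ k ∈ s, 0 < (-1 : ℝ) ^ k * ((-1) ^ e * w k) := fun k hk => by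
    have h := hwpos k hk
    have hke : k ≤ e := (Finset.mem_Icc.1 hk).2
    obtain ⟨m, hm⟩ := Nat.exists_eq_add_of_le hke
    have : (-1 : ℝ) ^ k * ((-1) ^ e * w k) = (-1) ^ (e - k) * w k := by
      rw [hm, Nat.add_sub_cancel_left, pow_add, mul_assoc, ← mul_assoc, ← pow_add, ← two_mul]
      simp
    rwa [this]
  have hterm : ∀ i, ∀ k ∈ s, 0 ≤ (if r k = i then (-1 : ℝ) ^ (b i) * ((-1) ^ e * w k) else 0) := by
    intro i k hk
    split_ifs with h
    · rw [← h, hr k (by have := (Finset.mem_Icc.1 hk).2; omega)]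
      exact (hwpos' k hk).le
    · rfl
  have hexp : ∀ i, (-1 : ℝ) ^ (b i) * (∑ k ∈ s, if r k = i then (-1) ^ e * w k else 0) =
      ∑ k ∈ s, if r k = i then (-1) ^ (b i) * ((-1) ^ e * w k) else 0 := fun i => by
    rw [Finset.mul_sum]; simp only [mul_ite, mul_zero]
  refine ⟨fun i => ∑ k ∈ s, if r k = i then (-1) ^ e * w k else 0, fun q hq => ?_, fun i => ?_, ?_⟩
  · have hc := Lagrange.coeff_eq_sum (s := s) (v := fun k => t (r k)) hv.injOn (P := q)
      (by
        rw [hcard]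
        exact lt_of_le_of_lt degree_le_natDegree (by exact_mod_cast (by omega)))
    rw [coeff_eq_zero_of_natDegree_lt (by omega)] at hc
    simp only [Finset.sum_mul]
    rw [Finset.sum_comm]
    simp only [ite_mul, zero_mul, Finset.sum_ite_eq, Finset.mem_univ, if_true]
    calc _ = (-1) ^ e * ∑ k ∈ s, eval (t (r k)) q / ∏ j ∈ s.erase k, (t (r k) - t (r j)) := by
          rw [Finset.mul_sum]
          refine Finset.sum_congr rfl fun k _ => ?_
          rw [hw, div_eq_mul_inv]; ring
      _ = 0 := by rw [← hc, mul_zero]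
  · rw [hexp]; exact Finset.sum_nonneg (hterm i)
  · rw [hexp]
    have hk0 : b i₀ ∈ s := Finset.mem_Icc.2 ⟨hae.2.2.1, hae.2.2.2⟩
    refine Finset.sum_pos' (hterm i₀) ⟨b i₀, hk0, ?_⟩
    rw [if_pos hr0]; exact hwpos' _ hk0

open Polynomial in
/-- The sum of the dependencies through the single points has no vanishing coefficient. -/
theorem exists_dependency_of_blocks {ι : Type*} [Fintype ι] {t : ι → ℝ} {b : ι → ℕ}
    (htb : ∀ i j, b i < b j → t i < t j) {c d : ℕ} (hd : d + 1 ≤ c)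
    (hb : ∀ i, b i ≤ c) (hs : ∀ k ≤ c, ∃ i, b i = k) :
    ∃ l : ι → ℝ, (∀ q : ℝ[X], q.natDegree ≤ d → ∑ i, l i * q.eval (t i) = 0) ∧
      ∀ i, 0 < (-1) ^ (b i) * l i := by
  choose l h1 h2 h3 using exists_local_dependency_of_blocks htb hd hb hs
  refine ⟨fun i => ∑ j, l j i, fun q hq => ?_, fun i => ?_⟩
  · simp only [Finset.sum_mul]
    rw [Finset.sum_comm]
    exact Finset.sum_eq_zero fun j _ => h1 j q hq
  · rw [Finset.mul_sum]
    exact Finset.sum_pos' (fun j _ => h2 j i) ⟨i, Finset.mem_univ i, h3 i⟩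

/-! ### Block indices of binary words -/

/-- The number of changes of letter in the word `f` before position `i`, that is, the index, counted
from `0`, of the maximal constant block of `f` that contains `i`. The total number of changes is
the value at `Fin.last n`. -/
def blockIndex {n : ℕ} (f : Fin (n + 1) → Bool) (i : Fin (n + 1)) : ℕ :=
  Fin.induction (motive := fun _ => ℕ) 0
    (fun j k => k + if f j.castSucc = f j.succ then 0 else 1) i

section
variable {n : ℕ} (f : Fin (n + 1) → Bool)

@[simp] theorem blockIndex_zero : blockIndex f 0 = 0 := rfl

theorem blockIndex_succ (j : Fin n) : blockIndex f j.succ =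
    blockIndex f j.castSucc + if f j.castSucc = f j.succ then 0 else 1 := rfl

theorem blockIndex_mono : Monotone (blockIndex f) :=
  Fin.monotone_iff_le_succ.2 fun j => by rw [blockIndex_succ]; omega

theorem blockIndex_even_iff (i : Fin (n + 1)) : Even (blockIndex f i) ↔ f i = f 0 := by
  induction i using Fin.induction with
  | zero => simp
  | succ j ih =>
    rw [blockIndex_succ]
    by_cases h : f j.castSucc = f j.succ
    · rw [if_pos h, add_zero, ih, h]
    · rw [if_neg h, Nat.even_add_one, ih]
      revert h
      cases f j.castSucc <;> cases f j.succ <;> cases f 0 <;> simp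

theorem exists_blockIndex_eq (i : Fin (n + 1)) : ∀ k ≤ blockIndex f i, ∃ j, blockIndex f j = k := by
  induction i using Fin.induction with
  | zero => intro k hk; exact ⟨0, by simp at hk ⊢; omega⟩
  | succ i ih =>
    intro k hk
    by_cases h : k ≤ blockIndex f i.castSucc
    · exact ih k h
    · refine ⟨i.succ, le_antisymm ?_ hk⟩
      rw [blockIndex_succ] at hk ⊢
      split_ifs at hk ⊢ <;> omega

theorem blockIndex_cons (x : Bool) (i : Fin (n + 1)) :
    blockIndex (Fin.cons x f : Fin (n + 2) → Bool) i.succ =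
      blockIndex f i + if x = f 0 then 0 else 1 := by
  induction i using Fin.induction with
  | zero => rw [blockIndex_succ]; simp
  | succ j ih =>
    rw [blockIndex_succ, ← Fin.succ_castSucc, ih, blockIndex_succ]
    simp only [Fin.cons_succ]
    omega

theorem blockIndex_last_le : blockIndex f (Fin.last n) ≤ n := by
  have : ∀ i : Fin (n + 1), blockIndex f i ≤ i := by
    intro i
    induction i using Fin.induction with
    | zero => simp
    | succ j ih =>
      rw [blockIndex_succ]
      simp only [Fin.val_castSucc, Fin.val_succ] at ih ⊢
      split_ifs <;> omega
  exact this (Fin.last n)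

end

/-! ### Counting binary words by their letter changes -/

/-- The number of compositions of `m` into `k` positive parts. -/
def numCompositions : ℕ → ℕ → ℕ
  | 0, 0 => 1
  | 0, _ + 1 => 0
  | _ + 1, 0 => 0
  | m + 1, k + 1 => m.choose k

theorem numCompositions_succ_succ (m k : ℕ) :
    numCompositions (m + 1) (k + 1) = numCompositions m (k + 1) + numCompositions m k := by
  cases m <;> cases k <;> simp [numCompositions, Nat.choose_succ_succ, add_comm]

theorem card_filter_cons {n : ℕ} (x : Bool) (Q : (Fin (n + 1) → Bool) → Prop) [DecidablePred Q] :
    (Finset.univ.filter fun f : Fin (n + 1) → Bool => f 0 = x ∧ Q f).card =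
      (Finset.univ.filter fun g : Fin n → Bool => Q (Fin.cons x g)).card := by
  symm
  refine Finset.card_bij (fun g _ => Fin.cons x g) (fun g hg => by simpa using hg)
    (fun g _ g' _ h => Fin.cons_right_injective _ h) (fun f hf => ?_)
  simp only [Finset.mem_filter, Finset.mem_univ, true_and] at hf
  refine ⟨Fin.tail f, ?_, ?_⟩
  · simp only [Finset.mem_filter, Finset.mem_univ, true_and]
    rw [← hf.1, Fin.cons_self_tail]; exact hf.2
  · rw [← hf.1, Fin.cons_self_tail]

theorem card_filter_eq_add_card_filter_eq_not {n : ℕ} (g : Fin n → Bool) (x : Bool) :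
    (Finset.univ.filter fun i => g i = x).card + (Finset.univ.filter fun i => g i = !x).card
      = n := by
  have := Finset.card_filter_add_card_filter_not (s := (Finset.univ : Finset (Fin n)))
    (fun i => g i = x)
  simp only [Finset.card_univ, Fintype.card_fin] at this
  refine Eq.trans ?_ this
  congr 3; ext i; cases g i <;> cases x <;> simp

/-- The words of length `a + b` with first letter `x`, with `a` letters `x` and with `c` changes of
letter: they consist of `c / 2 + 1` blocks of the letter `x`, interlaced with `(c + 1) / 2` blocks
of the other letter. -/
theorem card_words (n : ℕ) : ∀ (x : Bool) (a b c : ℕ), a + b = n + 1 →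
    (Finset.univ.filter fun f : Fin (n + 1) → Bool => f 0 = x ∧
      (Finset.univ.filter fun i => f i = x).card = a ∧ blockIndex f (Fin.last n) = c).card =
    numCompositions a (c / 2 + 1) * numCompositions b ((c + 1) / 2) := by
  induction n with
  | zero =>
    intro x a b c hab
    rw [card_filter_cons]
    have hc : ∀ g : Fin 0 → Bool, blockIndex (Fin.cons x g : Fin 1 → Bool) (Fin.last 0) = 0 :=
      fun g => rfl
    simp only [hc, Fin.card_filter_univ_succ, Fin.cons_zero, if_true]
    simp only [Finset.univ_eq_empty, Finset.filter_empty, Finset.card_empty, zero_add]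
    obtain ⟨rfl, rfl⟩ | ⟨rfl, rfl⟩ : (a = 0 ∧ b = 1) ∨ (a = 1 ∧ b = 0) := by omega
    · simp [numCompositions]
    · rcases c with _ | _ | c
      · simp [numCompositions]
      · simp [numCompositions]
      · have : (c + 1 + 1) / 2 = c / 2 + 1 := by omega
        simp [numCompositions, this]
  | succ n ih =>
    intro x a b c hab
    have hcard : ∀ g : Fin (n + 1) → Bool,
        (Finset.univ.filter fun i => (Fin.cons x g : Fin (n + 2) → Bool) i = x).card =
          (Finset.univ.filter fun i => g i = x).card + 1 := fun g => by
      rw [Fin.card_filter_univ_succ]; simp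
    rw [card_filter_cons]
    simp only [hcard, ← Fin.succ_last, blockIndex_cons]
    cases a with
    | zero => simp [numCompositions]
    | succ a =>
      have hab' : a + b = n + 1 := by omega
      simp only [Nat.add_right_cancel_iff]
      rw [← Finset.card_filter_add_card_filter_not (fun g : Fin (n + 1) → Bool => g 0 = x),
        numCompositions_succ_succ, add_mul]
      congr 1
      · rw [← ih x a b c hab', Finset.filter_filter]
        congr 1
        ext g
        simp only [Finset.mem_filter, Finset.mem_univ, true_and]
        constructor
        · rintro ⟨⟨h1, h2⟩, h3⟩
          exact ⟨h3, h1, by simpa [h3] using h2⟩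
        · rintro ⟨h3, h1, h2⟩
          exact ⟨⟨h1, by simpa [h3] using h2⟩, h3⟩
      · rw [Finset.filter_filter]
        have key : ∀ g : Fin (n + 1) → Bool,
            (((Finset.univ.filter fun i => g i = x).card = a ∧
              (blockIndex g (Fin.last n) + if x = g 0 then 0 else 1) = c) ∧ ¬ g 0 = x) ↔
            (g 0 = !x) ∧ (Finset.univ.filter fun i => g i = !x).card = b ∧
              blockIndex g (Fin.last n) + 1 = c := by
          intro g
          have h1 := card_filter_eq_add_card_filter_eq_not g x
          have h2 : (¬ g 0 = x) ↔ g 0 = !x := by cases g 0 <;> cases x <;> simp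
          rw [h2]
          constructor
          · rintro ⟨⟨h3, h4⟩, h5⟩
            rw [h5, if_neg (by simp)] at h4
            exact ⟨h5, by omega, h4⟩
          · rintro ⟨h5, h3, h4⟩
            rw [h5, if_neg (by simp)]
            exact ⟨⟨by omega, h4⟩, rfl⟩
        simp only [key]
        cases c with
        | zero =>
          have : numCompositions a 0 * numCompositions b 0 = 0 := by
            cases a <;> cases b <;> simp_all [numCompositions]
          simpa using this.symm
        | succ c =>
          simp only [Nat.add_right_cancel_iff]
          rw [ih (!x) b a c (by omega), mul_comm]
          congr 2
          omega

/-- The number of binary words with `d` letters of each kind, with a fixed first letter and with `c`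
changes of letter, for `d ≠ 0` (see `card_words`). -/
def numWords (d c : ℕ) : ℕ := numCompositions d (c / 2 + 1) * numCompositions d ((c + 1) / 2)

theorem numWords_zero {d : ℕ} (hd : d ≠ 0) : numWords d 0 = 0 := by
  cases d <;> simp_all [numWords, numCompositions]

theorem numWords_succ (e c : ℕ) :
    numWords (e + 1) (c + 1) = e.choose ((c + 1) / 2) * e.choose (c / 2) := by
  have : (c + 1 + 1) / 2 = c / 2 + 1 := by omega
  simp [numWords, numCompositions, this]

theorem numWords_even_add_odd (e k : ℕ) :
    numWords (e + 1) (2 * k) + numWords (e + 1) (2 * k + 1) = e.choose k * (e + 1).choose k := by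
  cases k with
  | zero => simp [numWords, numCompositions]
  | succ k =>
    rw [numWords_succ e (2 * (k + 1)), show 2 * (k + 1) = 2 * k + 1 + 1 by ring, numWords_succ,
      Nat.choose_succ_succ e k]
    have h2 : (2 * k + 1 + 1) / 2 = k + 1 := by omega
    have h3 : (2 * k + 1) / 2 = k := by omega
    have h4 : (2 * k + 1 + 1 + 1) / 2 = k + 1 := by omega
    rw [h2, h3, h4]; ring

theorem numWords_odd_add_even (e k : ℕ) :
    numWords (e + 1) (2 * k + 1) + numWords (e + 1) (2 * k + 2) =
      (e + 1).choose (k + 1) * e.choose k := by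
  rw [numWords_succ, show 2 * k + 2 = 2 * k + 1 + 1 from rfl, numWords_succ, Nat.choose_succ_succ]
  have h2 : (2 * k + 1 + 1) / 2 = k + 1 := by omega
  have h3 : (2 * k + 1) / 2 = k := by omega
  have h4 : 2 * k / 2 = k := by omega
  rw [h2, h3, h4]; ring

theorem sum_range_two_mul (g : ℕ → ℕ) (m : ℕ) :
    ∑ c ∈ Finset.range (2 * m), g c = ∑ k ∈ Finset.range m, (g (2 * k) + g (2 * k + 1)) := by
  induction m with
  | zero => simp
  | succ m ih => rw [Finset.sum_range_succ, ← ih, mul_add, mul_one, Finset.sum_range_succ,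
      Finset.sum_range_succ, add_assoc]

/-- Vandermonde's identity, after pairing the numbers of changes `2 * k` and `2 * k + 1`. -/
theorem sum_numWords (e : ℕ) :
    ∑ c ∈ Finset.range (2 * (e + 1)), numWords (e + 1) c = (2 * e + 1).choose e := by
  simp only [sum_range_two_mul, numWords_even_add_odd]
  rw [show 2 * e + 1 = (e + 1) + e by ring, Nat.add_choose_eq,
    Finset.Nat.sum_antidiagonal_eq_sum_range_succ (fun i j => (e + 1).choose i * e.choose j)]
  refine Finset.sum_congr rfl fun k hk => ?_
  rw [Nat.choose_symm (by simp at hk; omega), mul_comm]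

/-- The numbers of words are symmetric around the number of changes `e + 1`. -/
theorem numWords_reflect {e c : ℕ} (hc : c ≤ 2 * e) :
    numWords (e + 1) (2 * e - c + 1) = numWords (e + 1) (c + 1) := by
  rw [numWords_succ, numWords_succ]
  have h1 : (2 * e - c + 1) / 2 = e - c / 2 := by omega
  have h2 : (2 * e - c) / 2 = e - (c + 1) / 2 := by omega
  rw [h1, h2, Nat.choose_symm (by omega), Nat.choose_symm (by omega), mul_comm]

theorem two_mul_sum_numWords (e : ℕ) :
    2 * (∑ c ∈ Finset.Ico (e + 2) (2 * (e + 1)), numWords (e + 1) c) + numWords (e + 1) (e + 1) =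
      (2 * e + 1).choose e := by
  have h : ∑ c ∈ Finset.Ico (e + 2) (2 * (e + 1)), numWords (e + 1) c =
      ∑ c ∈ Finset.range (e + 1), numWords (e + 1) c := by
    rw [Finset.sum_range_succ', numWords_zero (by simp), add_zero, Finset.sum_Ico_eq_sum_range,
      show 2 * (e + 1) - (e + 2) = e by omega, ← Finset.sum_range_reflect]
    refine Finset.sum_congr rfl fun k hk => ?_
    have hk := Finset.mem_range.1 hk
    rw [← numWords_reflect (c := k) (by omega)]
    congr 1; omega
  rw [← sum_numWords, Finset.range_eq_Ico,
    ← Finset.sum_Ico_consecutive _ (show 0 ≤ e + 2 by omega) (show e + 2 ≤ 2 * (e + 1) by omega),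
    ← Finset.range_eq_Ico, Finset.sum_range_succ, ← h]
  ring

/-- The middle number of words is the square of a binomial coefficient, hence at most the sum of all
the squares in its row. -/
theorem numWords_self_le (e : ℕ) : numWords (e + 1) (e + 1) ≤ (2 * e).choose e := by
  rw [numWords_succ, ← Nat.sum_range_choose_sq]
  have h : (e + 1) / 2 = e - e / 2 := by omega
  rw [h, Nat.choose_symm (by omega), ← sq]
  exact Finset.single_le_sum (f := fun i => e.choose i ^ 2) (fun _ _ => Nat.zero_le _)
    (Finset.mem_range.2 (by omega))

theorem choose_le_six_mul_sum_numWords {e : ℕ} (he : 1 ≤ e) :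
    (2 * e + 1).choose e ≤ 6 * ∑ c ∈ Finset.Ico (e + 2) (2 * (e + 1)), numWords (e + 1) c := by
  have h1 := two_mul_sum_numWords e
  have h2 := numWords_self_le e
  have h3 : 3 * (2 * e).choose e ≤ 2 * (2 * e + 1).choose e := by
    have h4 := Nat.add_one_mul_choose_eq (2 * e) e
    have h5 : (2 * e + 1).choose (e + 1) = (2 * e + 1).choose e := by
      rw [← Nat.choose_symm_half]
    rw [h5] at h4
    nlinarith [Nat.zero_le ((2 * e).choose e)]
  omega

/-! ### Bounds for the central binomial coefficient -/

theorem four_pow_sq_le_mul_centralBinom_sq (n : ℕ) (hn : 1 ≤ n) :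
    (4 ^ n) ^ 2 ≤ 4 * n * n.centralBinom ^ 2 := by
  induction n, hn using Nat.le_induction with
  | base => simp [Nat.centralBinom, Nat.choose]
  | succ n hn ih =>
    have h := Nat.succ_mul_centralBinom_succ n
    have : (n + 1) * (4 ^ (n + 1)) ^ 2 ≤ (n + 1) * (4 * (n + 1) * (n + 1).centralBinom ^ 2) := by
      calc (n + 1) * (4 ^ (n + 1)) ^ 2 = 16 * (n + 1) * (4 ^ n) ^ 2 := by ring
        _ ≤ 16 * (n + 1) * (4 * n * n.centralBinom ^ 2) := Nat.mul_le_mul_left _ ih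
        _ = 16 * (4 * n * (n + 1)) * n.centralBinom ^ 2 := by ring
        _ ≤ 16 * ((2 * n + 1) ^ 2) * n.centralBinom ^ 2 := by gcongr; nlinarith
        _ = 4 * (2 * (2 * n + 1) * n.centralBinom) ^ 2 := by ring
        _ = 4 * ((n + 1) * (n + 1).centralBinom) ^ 2 := by rw [h]
        _ = _ := by ring
    exact Nat.le_of_mul_le_mul_left this (by omega)

theorem mul_centralBinom_sq_le_four_pow_sq (n : ℕ) : n * n.centralBinom ^ 2 ≤ (4 ^ n) ^ 2 := by
  suffices (2 * n + 1) * n.centralBinom ^ 2 ≤ (4 ^ n) ^ 2 by nlinarith [sq_nonneg n.centralBinom]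
  induction n with
  | zero => simp
  | succ n ih =>
    have h := Nat.succ_mul_centralBinom_succ n
    have : (n + 1) ^ 2 * ((2 * (n + 1) + 1) * (n + 1).centralBinom ^ 2) ≤
        (n + 1) ^ 2 * (4 ^ (n + 1)) ^ 2 := by
      calc (n + 1) ^ 2 * ((2 * (n + 1) + 1) * (n + 1).centralBinom ^ 2)
          = (2 * n + 3) * ((n + 1) * (n + 1).centralBinom) ^ 2 := by ring
        _ = (2 * n + 3) * (2 * (2 * n + 1) * n.centralBinom) ^ 2 := by rw [h]
        _ = 4 * ((2 * n + 3) * (2 * n + 1)) * ((2 * n + 1) * n.centralBinom ^ 2) := by ring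
        _ ≤ 4 * (4 * (n + 1) ^ 2) * (4 ^ n) ^ 2 :=
          Nat.mul_le_mul (Nat.mul_le_mul_left 4 (by nlinarith)) ih
        _ = _ := by ring
    exact Nat.le_of_mul_le_mul_left this (by positivity)

/-! ### Crossing pairs as words with many letter changes -/

theorem AreCrossing.symm {V : Type*} {d : ℕ} {p : V → EuclideanSpace ℝ (Fin d)} {A B : Set V}
    (h : AreCrossing p A B) : AreCrossing p B A :=
  ⟨h.1.symm, by rw [Set.inter_comm]; exact h.2⟩

/-- Combinatorial criterion for crossing. Read the vertices in the order of their parameters on the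
curve, starting with a vertex of `A`: the simplices on `A` and on its complement cross if and only
if the membership word changes its letter at least `d + 1` times. -/
theorem areCrossing_iff_le_blockIndex {V : Type*} [Fintype V] {d n : ℕ}
    {p : V → EuclideanSpace ℝ (Fin d)} {τ : V → ℝ}
    (hp : ∀ v (k : Fin d), p v k = τ v ^ ((k : ℕ) + 1)) (σ : Fin (n + 1) ≃ V)
    (hσ : StrictMono (τ ∘ σ)) {A : Set V} {f : Fin (n + 1) → Bool} (hf0 : f 0 = true)
    (hfA : ∀ i, f i = true ↔ σ i ∈ A) :
    AreCrossing p A Aᶜ ↔ d + 1 ≤ blockIndex f (Fin.last n) := by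
  set b : V → ℕ := fun v => blockIndex f (σ.symm v) with hb
  have hτ : ∀ v w, b v < b w → τ v < τ w := fun v w h => by
    have := hσ ((blockIndex_mono f).reflect_lt h)
    simpa using this
  have hle : ∀ v, b v ≤ blockIndex f (Fin.last n) := fun v => blockIndex_mono f (Fin.le_last _)
  have heven : ∀ v, Even (b v) ↔ v ∈ A := fun v => by
    rw [hb, blockIndex_even_iff, hf0, hfA, Equiv.apply_symm_apply]
  have hpos : ∀ v ∈ A, (-1 : ℝ) ^ b v = 1 := fun v hv => ((heven v).2 hv).neg_one_pow
  have hneg : ∀ v ∈ Aᶜ, (-1 : ℝ) ^ b v = -1 := fun v hv =>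
    (Nat.not_even_iff_odd.1 (mt (heven v).1 hv)).neg_one_pow
  constructor
  · contrapose!
    intro h
    obtain ⟨q, hq, hq'⟩ := exists_polynomial_of_blocks hτ hle
    refine not_areCrossing_of_polynomial hp q (by omega) (fun v hv => ?_) (fun v hv => ?_)
    · simpa [hpos v hv] using hq' v
    · simpa [hneg v hv] using hq' v
  · intro h
    obtain ⟨l, hl, hl'⟩ := exists_dependency_of_blocks hτ h hle fun k hk => by
      obtain ⟨j, hj⟩ := exists_blockIndex_eq f (Fin.last n) k hk
      exact ⟨σ j, by simpa [hb] using hj⟩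
    refine areCrossing_of_dependency hp ⟨σ 0, (hfA 0).1 hf0⟩ l hl (fun v hv => ?_) (fun v hv => ?_)
    · simpa [hpos v hv] using hl' v
    · simpa [hneg v hv] using hl' v

theorem exists_equiv_strictMono {N n : ℕ} (hN : n + 1 = N) {τ : Fin N → ℝ}
    (hτ : Function.Injective τ) : ∃ σ : Fin (n + 1) ≃ Fin N, StrictMono (τ ∘ σ) := by
  subst hN
  exact ⟨Tuple.sort τ, (Tuple.monotone_sort τ).strictMono_of_injective
    (hτ.comp (Tuple.sort τ).injective)⟩

theorem card_balanced_words_ge {d n : ℕ} (hn : n + 1 = 2 * d) :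
    (Finset.univ.filter fun f : Fin (n + 1) → Bool => f 0 = true ∧
      (Finset.univ.filter fun i => f i = true).card = d ∧
        d + 1 ≤ blockIndex f (Fin.last n)).card =
      ∑ c ∈ Finset.Ico (d + 1) (2 * d), numWords d c := by
  rw [Finset.card_eq_sum_card_fiberwise (f := fun f => blockIndex f (Fin.last n))
    (t := Finset.Ico (d + 1) (2 * d))]
  · refine Finset.sum_congr rfl fun c hc => ?_
    have hc := Finset.mem_Ico.1 hc
    rw [numWords, ← card_words n true d d c (by omega), Finset.filter_filter]
    congr 1
    ext f
    simp only [Finset.mem_filter, Finset.mem_univ, true_and]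
    constructor
    · rintro ⟨⟨h1, h2, -⟩, h3⟩; exact ⟨h1, h2, h3⟩
    · rintro ⟨h1, h2, h3⟩; exact ⟨⟨h1, h2, by omega⟩, h3⟩
  · intro f hf
    simp only [Finset.coe_filter, Finset.mem_univ, true_and, Set.mem_ofPred_eq] at hf
    have := blockIndex_last_le f
    simp only [Finset.coe_Ico, Set.mem_Ico]
    omega

/-- An unordered pair of complementary hyperedges is encoded by the membership word, along the
curve, of the hyperedge that contains the first vertex. -/
theorem numCrossingPairs_eq_sum {d : ℕ} (hd : 1 ≤ d) {p : Fin (2 * d) → EuclideanSpace ℝ (Fin d)}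
    (hp : IsMomentCurvePlacement p) :
    numCrossingPairs d p = ∑ c ∈ Finset.Ico (d + 1) (2 * d), numWords d c := by
  classical
  obtain ⟨hinj, hcurve⟩ := hp
  choose τ hτ using hcurve
  have hpτ : ∀ v (k : Fin d), p v k = τ v ^ ((k : ℕ) + 1) := fun v k => by rw [← hτ v]
  have hτinj : Function.Injective τ := fun v w h => hinj (by rw [← hτ v, ← hτ w, h])
  obtain ⟨n, hn⟩ : ∃ n, n + 1 = 2 * d := ⟨2 * d - 1, by omega⟩
  obtain ⟨σ, hσ⟩ := exists_equiv_strictMono hn hτinj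
  let S : (Fin (n + 1) → Bool) → Set (Fin (2 * d)) := fun f => σ '' {i | f i = true}
  have hS : ∀ f i, f i = true ↔ σ i ∈ S f := fun f i => by simp [S]
  have hScard : ∀ f, (S f).ncard = (Finset.univ.filter fun i => f i = true).card := fun f => by
    rw [Set.ncard_image_of_injective _ σ.injective, ← Set.ncard_coe_finset]
    congr 1; ext; simp
  have hcompl : ∀ A : Set (Fin (2 * d)), A.ncard = d → Aᶜ.ncard = d := fun A hA => by
    have := Set.ncard_add_ncard_compl A
    simp only [Nat.card_eq_fintype_card, Fintype.card_fin] at this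
    omega
  rw [← card_balanced_words_ge hn, numCrossingPairs, ← Set.ncard_coe_finset,
    ← Set.InjOn.ncard_image (f := fun f => s(S f, (S f)ᶜ))]
  · congr 1
    ext z
    constructor
    · have key : ∀ A : Set (Fin (2 * d)), A.ncard = d → AreCrossing p A Aᶜ → σ 0 ∈ A →
          ∃ f : Fin (n + 1) → Bool, (f 0 = true ∧
            (Finset.univ.filter fun i => f i = true).card = d ∧
              d + 1 ≤ blockIndex f (Fin.last n)) ∧ S f = A := by
        intro A hA hcr h0
        have hSf : S (fun i => decide (σ i ∈ A)) = A := by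
          ext v; simp [S]
        refine ⟨fun i => decide (σ i ∈ A), ⟨by simpa using h0, ?_, ?_⟩, hSf⟩
        · rw [← hScard, hSf, hA]
        · exact (areCrossing_iff_le_blockIndex hpτ σ hσ (by simpa using h0) (by simp)).1 hcr
      rintro ⟨A, hA, B, hB, hcr, rfl⟩
      -- two disjoint sets of `d` out of the `2 * d` vertices are complementary
      have hA : A.ncard = d := hA
      have hB : B.ncard = d := hB
      obtain rfl : B = Aᶜ := Set.eq_of_subset_of_ncard_le
        (Set.subset_compl_iff_disjoint_left.2 hcr.1) (by rw [hcompl A hA, hB])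
      by_cases h0 : σ 0 ∈ A
      · obtain ⟨f, hf, rfl⟩ := key A hA hcr h0
        exact ⟨f, by simpa using hf, rfl⟩
      · obtain ⟨f, hf, hfA⟩ := key Aᶜ hB (by rw [compl_compl]; exact hcr.symm) h0
        refine ⟨f, by simpa using hf, ?_⟩
        simp only [hfA, compl_compl]
        exact Sym2.eq_swap
    · rintro ⟨f, hf, rfl⟩
      simp only [Finset.coe_filter, Finset.mem_univ, true_and, Set.mem_ofPred_eq] at hf
      have hd' : (S f).ncard = d := by rw [hScard, hf.2.1]
      exact ⟨S f, hd', (S f)ᶜ, hcompl _ hd',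
        (areCrossing_iff_le_blockIndex hpτ σ hσ hf.1 (hS f)).2 hf.2.2, rfl⟩
  · intro f hf g hg h
    simp only [Finset.coe_filter, Finset.mem_univ, true_and, Set.mem_ofPred_eq] at hf hg
    rcases Sym2.eq_iff.1 h with ⟨h, -⟩ | ⟨h, -⟩
    · ext i
      rw [Bool.eq_iff_iff, hS, hS, h]
    · have h1 := (hS f 0).1 hf.1
      rw [h] at h1
      exact absurd ((hS g 0).1 hg.1) h1

theorem numCrossingPairs_add_sum {d : ℕ} (hd : 1 ≤ d) {p : Fin (2 * d) → EuclideanSpace ℝ (Fin d)}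
    (hp : IsMomentCurvePlacement p) :
    numCrossingPairs d p + ∑ c ∈ Finset.range (d + 1), numWords d c =
      (2 * d - 1).choose (d - 1) := by
  obtain ⟨e, rfl⟩ := Nat.exists_eq_add_of_le' hd
  rw [numCrossingPairs_eq_sum hd hp, show 2 * (e + 1) - 1 = 2 * e + 1 by omega,
    Nat.add_sub_cancel, ← sum_numWords, Finset.range_eq_Ico, Finset.range_eq_Ico, add_comm,
    Finset.sum_Ico_consecutive _ (by omega) (by omega)]

/-! ### The closed formulas and the order of growth -/

theorem sum_range_numWords_of_even {d : ℕ} (hd : 1 ≤ d) (h : Even d) :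
    ∑ c ∈ Finset.range (d + 1), numWords d c =
      ∑ i ∈ Finset.Icc 1 (d / 2), d.choose i * (d - 1).choose (i - 1) := by
  obtain ⟨e, rfl⟩ := Nat.exists_eq_add_of_le' hd
  rw [Finset.sum_range_succ', numWords_zero (by simp), add_zero, ← Finset.Ico_add_one_right_eq_Icc,
    Finset.sum_Ico_eq_sum_range]
  obtain ⟨m, hm⟩ := h.two_dvd
  rw [show Finset.range (e + 1) = Finset.range (2 * m) by rw [hm], sum_range_two_mul,
    show (e + 1) / 2 + 1 - 1 = m by omega]
  refine Finset.sum_congr rfl fun k _ => ?_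
  rw [numWords_odd_add_even, Nat.add_sub_cancel, Nat.add_sub_cancel_left, add_comm 1 k]

theorem sum_range_numWords_of_odd {d : ℕ} (h : Odd d) :
    ∑ c ∈ Finset.range (d + 1), numWords d c =
      1 + ∑ i ∈ Finset.Icc 1 (d / 2), (d - 1).choose i * d.choose i := by
  obtain ⟨m, rfl⟩ := h
  rw [show 2 * m + 1 + 1 = 2 * (m + 1) by ring, sum_range_two_mul, Finset.sum_range_succ',
    ← Finset.Ico_add_one_right_eq_Icc, Finset.sum_Ico_eq_sum_range,
    show (2 * m + 1) / 2 + 1 - 1 = m by omega, add_comm]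
  congr 1
  · rw [numWords_even_add_odd]; simp
  · refine Finset.sum_congr rfl fun k _ => ?_
    rw [numWords_even_add_odd, Nat.add_sub_cancel, add_comm 1 k]

theorem centralBinom_bounds {d : ℕ} (hd : 1 ≤ d) :
    (4 : ℝ) ^ d / √d ≤ 2 * d.centralBinom ∧ (d.centralBinom : ℝ) ≤ 4 ^ d / √d := by
  have hd0 : (0 : ℝ) < d := by exact_mod_cast hd
  have hs := Real.sqrt_pos.2 hd0
  have hss : √(d : ℝ) ^ 2 = d := Real.sq_sqrt hd0.le
  rw [div_le_iff₀ hs, le_div_iff₀ hs]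
  constructor
  · refine le_of_sq_le_sq (a := (4 : ℝ) ^ d) ?_ (by positivity)
    have := four_pow_sq_le_mul_centralBinom_sq d hd
    have h : ((4 : ℝ) ^ d) ^ 2 ≤ 4 * d * d.centralBinom ^ 2 := by exact_mod_cast this
    calc _ ≤ _ := h
      _ = _ := by rw [mul_pow, hss]; ring
  · refine le_of_sq_le_sq ?_ (by positivity)
    have := mul_centralBinom_sq_le_four_pow_sq d
    have h : (d : ℝ) * d.centralBinom ^ 2 ≤ ((4 : ℝ) ^ d) ^ 2 := by exact_mod_cast this
    calc _ = _ := by rw [mul_pow, hss]; ring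
      _ ≤ _ := h

/-- The symmetry of the numbers of words makes the crossing pairs a constant fraction of all
`Nat.centralBinom d / 2` pairs of complementary hyperedges. -/
theorem numCrossingPairs_bounds {d : ℕ} (hd : 2 ≤ d) {p : Fin (2 * d) → EuclideanSpace ℝ (Fin d)}
    (hp : IsMomentCurvePlacement p) :
    d.centralBinom ≤ 12 * numCrossingPairs d p ∧ numCrossingPairs d p ≤ d.centralBinom := by
  have h1 := numCrossingPairs_add_sum (by omega) hp
  rw [numCrossingPairs_eq_sum (by omega) hp] at h1 ⊢
  obtain ⟨e, rfl⟩ := Nat.exists_eq_add_of_le' (show 1 ≤ d by omega)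
  have h2 : (2 * e + 1).choose e ≤
      6 * ∑ c ∈ Finset.Ico (e + 1 + 1) (2 * (e + 1)), numWords (e + 1) c :=
    choose_le_six_mul_sum_numWords (by omega)
  have h3 : (e + 1).centralBinom = 2 * (2 * e + 1).choose e := by
    rw [Nat.centralBinom_eq_two_mul_choose, show 2 * (e + 1) = 2 * e + 1 + 1 by ring,
      Nat.choose_succ_succ, ← Nat.choose_symm_half]
    simp only [Nat.succ_eq_add_one]; ring
  rw [show 2 * (e + 1) - 1 = 2 * e + 1 by omega, Nat.add_sub_cancel] at h1
  constructor <;> omega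

theorem theorem2 :
    (∀ (d : ℕ), 2 ≤ d →
      ∀ p : Fin (2 * d) → EuclideanSpace ℝ (Fin d), IsMomentCurvePlacement p →
        (Even d →
          (numCrossingPairs d p : ℤ) =
            (Nat.choose (2 * d - 1) (d - 1) : ℤ) -
              ∑ i ∈ Finset.Icc 1 (d / 2),
                (Nat.choose d i : ℤ) * (Nat.choose (d - 1) (i - 1) : ℤ)) ∧
        (Odd d →
          (numCrossingPairs d p : ℤ) =
            (Nat.choose (2 * d - 1) (d - 1) : ℤ) - 1 -
              ∑ i ∈ Finset.Icc 1 (d / 2),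
                (Nat.choose (d - 1) i : ℤ) * (Nat.choose d i : ℤ))) ∧
    (∀ p : (d : ℕ) → Fin (2 * d) → EuclideanSpace ℝ (Fin d),
      (∀ d, 2 ≤ d → IsMomentCurvePlacement (p d)) →
        Asymptotics.IsTheta Filter.atTop
          (fun d : ℕ => (numCrossingPairs d (p d) : ℝ))
          (fun d : ℕ => (4 : ℝ) ^ d / Real.sqrt (d : ℝ))) := by
  refine ⟨fun d hd p hp => ⟨fun h => ?_, fun h => ?_⟩, fun p hp => ⟨?_, ?_⟩⟩
  · rw [← numCrossingPairs_add_sum (by omega) hp, sum_range_numWords_of_even (by omega) h]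
    push_cast; ring
  · rw [← numCrossingPairs_add_sum (by omega) hp, sum_range_numWords_of_odd h]
    push_cast; ring
  · refine Asymptotics.IsBigO.of_bound 1 (Filter.eventually_atTop.2 ⟨2, fun d hd => ?_⟩)
    have h1 := (centralBinom_bounds (show 1 ≤ d by omega)).2
    have h2 : (numCrossingPairs d (p d) : ℝ) ≤ d.centralBinom := by
      exact_mod_cast (numCrossingPairs_bounds hd (hp d hd)).2
    rw [Real.norm_of_nonneg (by positivity), Real.norm_of_nonneg (by positivity)]
    linarith
  · refine Asymptotics.IsBigO.of_bound 24 (Filter.eventually_atTop.2 ⟨2, fun d hd => ?_⟩)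
    have h1 := (centralBinom_bounds (show 1 ≤ d by omega)).1
    have h2 : (d.centralBinom : ℝ) ≤ 12 * numCrossingPairs d (p d) := by
      exact_mod_cast (numCrossingPairs_bounds hd (hp d hd)).1
    rw [Real.norm_of_nonneg (by positivity), Real.norm_of_nonneg (by positivity)]
    linarith
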